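/- All spaces are Tychonoff (completely regular Hausdorff). For a space $X$ with a base point $x_0\in X$, let $B_G(X)$ denote the Graev free Boolean topological group of $X$: the free Boolean group generated by $X\setminus\{x_0\}$, with $x_0$ identified with the zero element, equipped with the finest group topology for which the canonical map $X\to B_G(X)$ is continuous (equivalently, every continuous map from $X$ to a Boolean topological group taking $x_0$ to $0$ extends uniquely to a continuous homomorphism on $B_G(X)$; up to topological isomorphism, $B_G(X)$ does not depend on $x_0$). A cozero set is a set of the form $\{x: f(x)\neq 0\}$ with $f$ continuous and real-valued. A topological group is an $F'$-group if any two disjoint cozero sets in it have disjoint closures. A point $x\in X$ is a $P$-point if every $G_\delta$-set containing $x$ is a neighborhood of $x$, and $X$ is a $P$-space if all of its points are $P$-points. A continuous surjection $p\colon X\to Z$ is $\mathbb R$-quotient if a function $\varphi\colon Z\to\mathbb R$ is continuous if and only if $\varphi\circ p$ is continuous. **Theorem.** Let $X$ be a (nonempty) Tychonoff space such that $B_G(X)$ is an $F'$-group. Then: 1. $X$ contains at most one point that is not a $P$-point. 2. If $X$ is not a $P$-space, then there exist a countable Tychonoff space $Z$ with a unique nonisolated point and an $\mathbb R$-quotient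 map $p\colon X\to Z$ such that $B_G(Z)$ (with base point $p(x_0)$) is extremally disconnected and is a topological quotient of $B_G(X)$, namely, there is a homomorphism $B_G(X)\to B_G(Z)$ that extends $p$ and is a topological quotient map. -/

import Mathlib

open Set Filter Topology

universe u v

/-- A cozero set: the set of points where some continuous real-valued function is nonzero. -/
def IsCozero {X : Type u} [TopologicalSpace X] (U : Set X) : Prop :=
  ∃ f : X → ℝ, Continuous f ∧ U = {x | f x ≠ 0}

/-- `X` is an `F'`-space: disjoint cozero sets have disjoint closures. -/
def IsFPrimeSpace (X : Type u) [TopologicalSpace X] : Prop :=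
  ∀ U V : Set X, IsCozero U → IsCozero V → Disjoint U V → Disjoint (closure U) (closure V)

/-- `S` is a `P`-set: every `G_δ`-set containing `S` is a neighborhood of `S`. -/
def IsPSet {X : Type u} [TopologicalSpace X] (S : Set X) : Prop :=
  ∀ G : Set X, IsGδ G → S ⊆ G → G ∈ 𝓝ˢ S

/-- `x` is a `P`-point: the singleton `{x}` is a `P`-set. -/
def IsPPoint {X : Type u} [TopologicalSpace X] (x : X) : Prop :=
  IsPSet ({x} : Set X)

/-- `X` is a `P`-space: every point is a `P`-point. -/
def IsPSpace (X : Type u) [TopologicalSpace X] : Prop :=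
  ∀ x : X, IsPPoint x

/-- `p` is an `ℝ`-quotient map: a continuous surjection such that a function `φ : Y → ℝ` is
continuous if and only if `φ ∘ p` is. -/
def IsRQuotientMap {X : Type u} {Y : Type v} [TopologicalSpace X] [TopologicalSpace Y]
    (p : X → Y) : Prop :=
  Continuous p ∧ Function.Surjective p ∧
    ∀ φ : Y → ℝ, Continuous φ ↔ Continuous (φ ∘ p)

/-- The Graev free Boolean group on `X` with base point `x₀`: the free Boolean group (that is, the
vector space over the two-element field) with basis `X \ {x₀}`; the base point becomes zero. -/
def FreeBooleanGraev (X : Type u) (x₀ : X) : Type u :=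
  {x : X // x ≠ x₀} →₀ ZMod 2

namespace FreeBooleanGraev

noncomputable instance (X : Type u) (x₀ : X) : AddCommGroup (FreeBooleanGraev X x₀) :=
  inferInstanceAs (AddCommGroup ({x : X // x ≠ x₀} →₀ ZMod 2))

/-- The basis element that corresponds to a point other than the base point. -/
noncomputable def gen {X : Type u} {x₀ : X} (x : {x : X // x ≠ x₀}) : FreeBooleanGraev X x₀ :=
  (Finsupp.single x 1 : {x : X // x ≠ x₀} →₀ ZMod 2)

open Classical in
/-- The canonical map of `X` to the free Boolean group; it sends `x₀` to `0`. -/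
noncomputable def of {X : Type u} (x₀ : X) (x : X) : FreeBooleanGraev X x₀ :=
  if h : x = x₀ then 0 else gen ⟨x, h⟩

/-- The free topology: the finest group topology for which the canonical map of `X` to the group
is continuous. The universal property is `FreeBooleanGraev.existsUnique_lift` below. -/
noncomputable instance (X : Type u) [TopologicalSpace X] (x₀ : X) : TopologicalSpace (FreeBooleanGraev X x₀) :=
  (AddGroupTopology.coinduced (of x₀)).toTopologicalSpace

instance (X : Type u) [TopologicalSpace X] (x₀ : X) :
    IsTopologicalAddGroup (FreeBooleanGraev X x₀) :=
  (AddGroupTopology.coinduced (of x₀)).toIsTopologicalAddGroup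

theorem of_base {X : Type u} (x₀ : X) : of x₀ x₀ = 0 := by
  unfold of; rw [dif_pos rfl]

theorem of_ne {X : Type u} (x₀ : X) (x : {x : X // x ≠ x₀}) :
    of x₀ x.1 = gen x := by
  unfold of; rw [dif_neg x.2]

theorem add_self {X : Type u} (x₀ : X) (a : FreeBooleanGraev X x₀) : a + a = 0 := by
  have h : ∀ b : {x : X // x ≠ x₀} →₀ ZMod 2, b + b = 0 := fun b => by
    ext i; exact CharTwo.add_self_eq_zero (b i)
  exact h a

theorem continuous_of {X : Type u} [TopologicalSpace X] (x₀ : X) : Continuous (of x₀) :=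
  AddGroupTopology.coinduced_continuous (of x₀)

/-- The universal property: every continuous map `f` of `X` to a Boolean topological group with
`f x₀ = 0` extends uniquely to a homomorphism, and the extension is continuous. -/
theorem existsUnique_lift {X : Type u} [TopologicalSpace X] (x₀ : X) {H : Type v} [AddCommGroup H]
    [TopologicalSpace H] [IsTopologicalAddGroup H] (hH : ∀ a : H, a + a = 0)
    (f : X → H) (hf : Continuous f) (hf₀ : f x₀ = 0) :
    ∃ φ : FreeBooleanGraev X x₀ →+ H,
      (Continuous φ ∧ ∀ x, φ (of x₀ x) = f x) ∧
        ∀ ψ : FreeBooleanGraev X x₀ →+ H, (∀ x, ψ (of x₀ x) = f x) → ψ = φ := by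
  let φ : ({x : X // x ≠ x₀} →₀ ZMod 2) →+ H := Finsupp.liftAddHom fun x =>
    ZMod.lift 2 ⟨zmultiplesHom H (f x.1), by simpa [two_zsmul] using hH (f x.1)⟩
  let φ' : FreeBooleanGraev X x₀ →+ H := φ
  have hφ : ∀ x, φ' (of x₀ x) = f x := by
    intro x
    by_cases h : x = x₀
    · subst h; rw [of_base, map_zero, hf₀]
    · rw [of_ne x₀ ⟨x, h⟩]
      change φ (Finsupp.single ⟨x, h⟩ 1) = f x
      have h1 : ∀ g : {g : ℤ →+ H // g (2 : ℕ) = 0}, ZMod.lift 2 g (1 : ZMod 2) = g.1 1 := by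
        intro g
        have := ZMod.lift_coe 2 g 1
        simpa using this
      simp only [φ, Finsupp.liftAddHom_apply_single, h1]
      simp
  refine ⟨φ', ⟨?_, hφ⟩, ?_⟩
  · let t : AddGroupTopology (FreeBooleanGraev X x₀) :=
      { toTopologicalSpace := TopologicalSpace.induced φ' inferInstance
        toIsTopologicalAddGroup := topologicalAddGroup_induced φ' }
    have ht : TopologicalSpace.coinduced (of x₀) inferInstance ≤ t.toTopologicalSpace := by
      rw [← continuous_iff_coinduced_le]
      refine continuous_induced_rng.2 ?_
      have : φ' ∘ of x₀ = f := funext hφ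
      rw [this]; exact hf
    have hle : AddGroupTopology.coinduced (of x₀) ≤ t := sInf_le ht
    exact continuous_iff_le_induced.2 hle
  · intro ψ hψ
    have key : ∀ a b : ({x : X // x ≠ x₀} →₀ ZMod 2) →+ H,
        (∀ x, a (Finsupp.single x 1) = b (Finsupp.single x 1)) → a = b := by
      intro a b hab
      refine Finsupp.addHom_ext fun x y => ?_
      fin_cases y
      · exact (congrArg a (Finsupp.single_zero x)).trans ((map_zero a).trans
          ((map_zero b).symm.trans (congrArg b (Finsupp.single_zero x)).symm))
      · exact hab x
    refine key ψ φ' fun x => ?_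
    have h1 := hψ x.1
    have h2 := hφ x.1
    rw [of_ne] at h1 h2
    exact h1.trans h2.symm

end FreeBooleanGraev

/-! The Graev free Boolean group `B(X)` being an `F'`-space is exploited through two constructions.

A point `x` that is not a `P`-point is a zero, but not a local zero, of some continuous
`f : X → [0, 1]` (`exists_continuous_of_not_isPPoint`). If `x ≠ y` are two such points, the
functions `f` and `g` can be chosen to vanish near the other point. The map sending `t` to the
indicator function of `(-∞, t)` is a continuous map of `ℝ` to a seminormed Boolean group
(`StepGroup`, the `L¹`-seminorm on measurable functions with values in `ZMod 2`), so `f` and `g`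
induce continuous homomorphisms `F` and `G` on `B(X)`. As `u → x`, the elements `u - x` tend
to `0` with `G (u - x) = 0` eventually and `‖F (u - x)‖ > 0` frequently, and symmetrically at `y`.
Hence `0` is in the closures of the disjoint cozero sets `{‖G‖ < ‖F‖}` and `{‖F‖ < ‖G‖}`.

If `x` is the only point that is not a `P`-point, then `f` is locally constant off its zero set and
its zero set is a neighborhood of each of its points other than `x`. Collapsing the zero set and
the sets `{n ≤ 1 / f < n + 1}` gives a countable quotient `Z` with a single nonisolated point.
A quotient map `X → Z` induces an open quotient map `B(X) → B(Z)`, so `B(Z)` is again an `F'`-space.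
Being countable and completely regular, it has all its open sets cozero, and an `F'`-space with this
property is extremally disconnected.
-/

/-! ### Zero sets and cozero sets -/

/-- A countable intersection of zero sets is a zero set. -/
theorem exists_continuous_eq_zero_iff_forall {X : Type*} [TopologicalSpace X] {ι : Type*}
    [Countable ι] (f : ι → X → ℝ) (hf : ∀ i, Continuous (f i))
    (h01 : ∀ i x, f i x ∈ Icc (0 : ℝ) 1) :
    ∃ F : X → ℝ, Continuous F ∧ (∀ x, F x ∈ Icc (0 : ℝ) 1) ∧ ∀ x, F x = 0 ↔ ∀ i, f i x = 0 := by
  have := Encodable.ofCountable ι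
  obtain ⟨w, hw, c, hc, -⟩ := posSumOfEncodable one_pos ι
  have hnn : ∀ i x, 0 ≤ w i * f i x := fun i x => mul_nonneg (hw i).le (h01 i x).1
  have hle : ∀ i x, w i * f i x ≤ w i := fun i x => mul_le_of_le_one_right (hw i).le (h01 i x).2
  have hsum : ∀ x, Summable fun i => w i * f i x := fun x =>
    Summable.of_nonneg_of_le (fun i => hnn i x) (fun i => hle i x) hc.summable
  have hcont : Continuous fun x => ∑' i, w i * f i x :=
    continuous_tsum (fun i => (hf i).const_mul (w i)) hc.summable fun i x => by
      rw [Real.norm_of_nonneg (hnn i x)]; exact hle i x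
  have hpos : ∀ x, 0 ≤ ∑' i, w i * f i x := fun x => tsum_nonneg fun i => hnn i x
  refine ⟨fun x => min 1 (∑' i, w i * f i x), continuous_const.min hcont,
    fun x => ⟨le_min zero_le_one (hpos x), min_le_left _ _⟩, fun x => ?_⟩
  have hmin : min 1 (∑' i, w i * f i x) = 0 ↔ ∑' i, w i * f i x = 0 := by
    constructor
    · intro h
      rcases min_choice 1 (∑' i, w i * f i x) with h' | h' <;> linarith
    · intro h; rw [h]; exact min_eq_right zero_le_one
  rw [hmin, ← (hsum x).hasSum_iff, hasSum_zero_iff_of_nonneg fun i => hnn i x, funext_iff]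
  exact forall_congr' fun i => by simp [(hw i).ne']

/-- A point that is not a `P`-point is a zero of some continuous function without being an interior
point of its zero set. -/
theorem exists_continuous_of_not_isPPoint {X : Type*} [TopologicalSpace X]
    [CompletelyRegularSpace X] {x : X} (hx : ¬ IsPPoint x) :
    ∃ f : X → ℝ, Continuous f ∧ (∀ u, f u ∈ Icc (0 : ℝ) 1) ∧ f x = 0 ∧ ∃ᶠ u in 𝓝 x, f u ≠ 0 := by
  simp only [IsPPoint, IsPSet, not_forall, nhdsSet_singleton, singleton_subset_iff] at hx
  obtain ⟨G, hG, hxG, hGx⟩ := hx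
  obtain ⟨U, hU, rfl⟩ := isGδ_iff_eq_iInter_nat.1 hG
  choose f hf hfx hfU using fun n =>
    CompletelyRegularSpace.completely_regular_isOpen x (U n) (hU n) (mem_iInter.1 hxG n)
  obtain ⟨F, hF, hF01, hF0⟩ := exists_continuous_eq_zero_iff_forall
    (fun n u => (f n u : ℝ)) (fun n => continuous_subtype_val.comp (hf n)) fun n u => (f n u).2
  refine ⟨F, hF, hF01, (hF0 x).2 fun n => by simp [hfx n], fun h => hGx ?_⟩
  filter_upwards [h] with u hu
  refine mem_iInter.2 fun n => by_contra fun hun => ?_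
  have h0 := (hF0 u).1 (not_not.1 hu) n
  have h1 := hfU n hun
  simp [h1] at h0

/-- The function of `exists_continuous_of_not_isPPoint` can be cut off near any other point. -/
theorem exists_continuous_of_not_isPPoint_of_ne {X : Type*} [TopologicalSpace X]
    [T35Space X] {x y : X} (hx : ¬ IsPPoint x) (hxy : x ≠ y) :
    ∃ f : X → ℝ, Continuous f ∧ (∀ u, f u ∈ Icc (0 : ℝ) 1) ∧ f x = 0 ∧
      (∃ᶠ u in 𝓝 x, f u ≠ 0) ∧ f y = 0 ∧ ∀ᶠ u in 𝓝 y, f u = 0 := by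
  obtain ⟨f, hf, hf01, hfx, hfne⟩ := exists_continuous_of_not_isPPoint hx
  obtain ⟨V, W, hV, hW, hxV, hyW, hVW⟩ := t2_separation hxy
  obtain ⟨h, hh, hhx, hhV⟩ := CompletelyRegularSpace.completely_regular_isOpen x V hV hxV
  have hyz : ∀ᶠ u in 𝓝 y, f u * (1 - (h u : ℝ)) = 0 := by
    filter_upwards [hW.mem_nhds hyW] with u hu
    have : h u = 1 := hhV (hVW.notMem_of_mem_right hu)
    simp [this]
  refine ⟨fun u => f u * (1 - (h u : ℝ)), by fun_prop, fun u => ?_, by simp [hfx], ?_,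
    hyz.self_of_nhds, hyz⟩
  · have h1 := (h u).2.1
    have h2 := (h u).2.2
    exact ⟨mul_nonneg (hf01 u).1 (by linarith), mul_le_one₀ (hf01 u).2 (by linarith) (by linarith)⟩
  · have hlt : ∀ᶠ u in 𝓝 x, (h u : ℝ) < 1 :=
      (continuous_subtype_val.comp hh).continuousAt.eventually_lt continuousAt_const
        (by simp [hhx])
    exact (hfne.and_eventually hlt).mono fun u hu =>
      mul_ne_zero hu.1 (by linarith [hu.2])

theorem isCozero_lt {X : Type*} [TopologicalSpace X] {f g : X → ℝ} (hf : Continuous f)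
    (hg : Continuous g) : IsCozero {x | f x < g x} := by
  refine ⟨fun x => max (g x - f x) 0, (hg.sub hf).max continuous_const, ?_⟩
  ext x
  simp

theorem IsCozero.preimage {X Y : Type*} [TopologicalSpace X] [TopologicalSpace Y] {p : X → Y}
    (hp : Continuous p) {U : Set Y} (hU : IsCozero U) : IsCozero (p ⁻¹' U) := by
  obtain ⟨f, hf, rfl⟩ := hU
  exact ⟨f ∘ p, hf.comp hp, rfl⟩

theorem IsOpen.isCozero_of_countable {X : Type*} [TopologicalSpace X] [CompletelyRegularSpace X]
    [Countable X] {U : Set X} (hU : IsOpen U) : IsCozero U := by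
  choose f hf hfx hfU using fun a : U =>
    CompletelyRegularSpace.completely_regular_isOpen a.1 U hU a.2
  obtain ⟨F, hF, -, hF0⟩ := exists_continuous_eq_zero_iff_forall
    (fun a u => 1 - (f a u : ℝ))
    (fun a => continuous_const.sub (continuous_subtype_val.comp (hf a)))
    fun a u => ⟨sub_nonneg.2 (f a u).2.2, sub_le_self _ (f a u).2.1⟩
  refine ⟨F, hF, Set.ext fun u => ⟨fun hu h0 => ?_, fun hu => by_contra fun hu' => hu ?_⟩⟩
  · have := (hF0 u).1 h0 ⟨u, hu⟩
    simp [hfx ⟨u, hu⟩] at this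
  · refine (hF0 u).2 fun a => ?_
    have : f a u = 1 := hfU a hu'
    simp [this]

theorem IsFPrimeSpace.of_isOpenQuotientMap {X Y : Type*} [TopologicalSpace X] [TopologicalSpace Y]
    (hX : IsFPrimeSpace X) {p : X → Y} (hp : IsOpenQuotientMap p) : IsFPrimeSpace Y := by
  intro U V hU hV hUV
  have h := hX _ _ (hU.preimage hp.continuous) (hV.preimage hp.continuous) (hUV.preimage p)
  rw [← hp.isOpenMap.preimage_closure_eq_closure_preimage hp.continuous,
    ← hp.isOpenMap.preimage_closure_eq_closure_preimage hp.continuous] at h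
  exact Disjoint.of_preimage hp.surjective h

theorem IsFPrimeSpace.extremallyDisconnected_of_countable {X : Type*} [TopologicalSpace X]
    [CompletelyRegularSpace X] [Countable X] (hX : IsFPrimeSpace X) :
    ExtremallyDisconnected X := by
  refine ⟨fun U hU => ?_⟩
  have hV : IsOpen (closure U)ᶜ := isClosed_closure.isOpen_compl
  have hd := hX U (closure U)ᶜ hU.isCozero_of_countable hV.isCozero_of_countable
    (disjoint_compl_right.mono_left subset_closure)
  have heq : closure (closure U)ᶜ = (closure U)ᶜ :=
    (subset_compl_iff_disjoint_left.2 hd).antisymm subset_closure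
  exact isClosed_compl_iff.1 (closure_eq_iff_isClosed.1 heq)

/-! ### A connected seminormed Boolean group -/

/-- The group of functions `ℝ → ZMod 2` with Borel support, that is, of Borel sets of reals under
symmetric difference. -/
def borelSupportSubgroup : AddSubgroup (ℝ → ZMod 2) where
  carrier := {g | MeasurableSet {t | g t ≠ 0}}
  zero_mem' := by simp
  add_mem' {a b} ha hb := by
    have h : {t | (a + b) t ≠ 0} = symmDiff {t | a t ≠ 0} {t | b t ≠ 0} := by
      ext t
      simp only [Pi.add_apply, mem_symmDiff, mem_ofPred_eq]
      generalize a t = i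
      generalize b t = j
      revert i j
      decide
    change MeasurableSet {t | (a + b) t ≠ 0}
    rw [h]
    exact MeasurableSet.symmDiff (s₁ := {t | a t ≠ 0}) ha hb
  neg_mem' {a} ha := by simpa using ha

/-- The Boolean group `borelSupportSubgroup` as a type of its own, to be topologized by a seminorm
rather than by pointwise convergence. -/
def StepGroup : Type := borelSupportSubgroup

namespace StepGroup

open MeasureTheory

noncomputable instance : AddCommGroup StepGroup := 
  inferInstanceAs (AddCommGroup borelSupportSubgroup)

/-- The function underlying an element of the group. -/
def toFun (g : StepGroup) : ℝ → ZMod 2 := g.1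

/-- The `L¹`-seminorm on `[0, 1]`: the measure of the part of the support in `[0, 1]`. -/
noncomputable def seminorm : AddGroupSeminorm StepGroup where
  toFun g := (volume.restrict (Icc (0 : ℝ) 1)).real {t | g.toFun t ≠ 0}
  map_zero' := by
    have : {t : ℝ | (0 : StepGroup).toFun t ≠ 0} = ∅ := by
      ext t
      have : (0 : StepGroup).toFun t = 0 := rfl
      simp [this]
    rw [this, measureReal_empty]
  add_le' a b := by
    refine (measureReal_mono (fun t ht => ?_)).trans (measureReal_union_le _ _)
    by_contra h
    have hab : (a + b).toFun t = a.toFun t + b.toFun t := rfl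
    simp only [mem_union, mem_ofPred_eq, not_or, not_not] at h ht
    exact ht (by rw [hab, h.1, h.2, add_zero])
  neg' a := by
    have : ∀ t, (-a).toFun t = -a.toFun t := fun _ => rfl
    simp [this]

noncomputable instance : SeminormedAddCommGroup StepGroup :=
  seminorm.toSeminormedAddCommGroup

theorem norm_def (g : StepGroup) :
    ‖g‖ = (volume.restrict (Icc (0 : ℝ) 1)).real {t | g.toFun t ≠ 0} := rfl

theorem add_self (g : StepGroup) : g + g = 0 :=
  Subtype.ext (funext fun t => CharTwo.add_self_eq_zero (g.toFun t))

open Classical in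
/-- The indicator function of `(-∞, s)`. -/
noncomputable def step (s : ℝ) : StepGroup :=
  ⟨fun t => if t < s then 1 else 0, by
    change MeasurableSet {t : ℝ | (if t < s then (1 : ZMod 2) else 0) ≠ 0}
    have h : {t : ℝ | (if t < s then (1 : ZMod 2) else 0) ≠ 0} = Iio s := by ext t; simp
    rw [h]
    exact measurableSet_Iio⟩

theorem support_step_sub {s s' : ℝ} (h : s ≤ s') :
    {t | (step s' - step s).toFun t ≠ 0} = Ico s s' := by
  ext t
  have : (step s' - step s).toFun t = (if t < s' then 1 else 0) - (if t < s then 1 else 0) := rfl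
  rw [mem_ofPred_eq, this]
  by_cases h1 : t < s
  · simp [h1, h1.trans_le h]
  · by_cases h2 : t < s' <;> simp [h1, h2, not_lt.1 h1]

theorem continuous_step : Continuous step := by
  refine LipschitzWith.continuous (K := 1) (LipschitzWith.of_dist_le_mul fun s' s => ?_)
  wlog h : s ≤ s' generalizing s s'
  · rw [dist_comm, dist_comm s']; exact this s s' (le_of_not_ge h)
  rw [dist_eq_norm, norm_def, support_step_sub h, Real.dist_eq, abs_of_nonneg (sub_nonneg.2 h),
    NNReal.coe_one, one_mul, measureReal_restrict_apply measurableSet_Ico]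
  refine (measureReal_mono inter_subset_left (by simp)).trans ?_
  rw [Real.volume_real_Ico_of_le h]

theorem norm_step_sub_pos {s : ℝ} (hs : s ∈ Icc (0 : ℝ) 1) (h0 : s ≠ 0) :
    0 < ‖step s - step 0‖ := by
  have h : Ico 0 s ∩ Icc (0 : ℝ) 1 = Ico 0 s :=
    inter_eq_left.2 fun t ht => ⟨ht.1, ht.2.le.trans hs.2⟩
  rw [norm_def, support_step_sub hs.1, measureReal_restrict_apply measurableSet_Ico, h,
    Real.volume_real_Ico_of_le hs.1, sub_zero]
  exact lt_of_le_of_ne hs.1 h0.symm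

end StepGroup

/-! ### Free Boolean groups -/

namespace FreeBooleanGraev

theorem hom_ext {X : Type*} {x₀ : X} {H : Type*} [AddCommGroup H]
    {φ ψ : FreeBooleanGraev X x₀ →+ H} (h : ∀ x, φ (of x₀ x) = ψ (of x₀ x)) : φ = ψ := by
  have key : ∀ a b : ({x : X // x ≠ x₀} →₀ ZMod 2) →+ H,
      (∀ x, a (Finsupp.single x 1) = b (Finsupp.single x 1)) → a = b := by
    intro a b hab
    refine Finsupp.addHom_ext fun x y => ?_
    fin_cases y
    · exact (congrArg a (Finsupp.single_zero x)).trans ((map_zero a).trans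
        ((map_zero b).symm.trans (congrArg b (Finsupp.single_zero x)).symm))
    · exact hab x
  refine key φ ψ fun x => ?_
  have := h x.1
  rwa [of_ne] at this

instance {X : Type*} [Countable X] (x₀ : X) : Countable (FreeBooleanGraev X x₀) :=
  inferInstanceAs (Countable ({x : X // x ≠ x₀} →₀ ZMod 2))

instance {X : Type*} [TopologicalSpace X] (x₀ : X) :
    CompletelyRegularSpace (FreeBooleanGraev X x₀) :=
  let _ := IsTopologicalAddGroup.rightUniformSpace (FreeBooleanGraev X x₀)
  UniformSpace.toCompletelyRegularSpace

/-- A quotient map of spaces induces a quotient map of free Boolean groups: the free group of the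
codomain is identified with the topological quotient by the kernel, by the universal properties of
the two groups. -/
theorem exists_isQuotientMap {X Z : Type*} [TopologicalSpace X] [TopologicalSpace Z] {p : X → Z}
    (hp : IsQuotientMap p) (x₀ : X) :
    ∃ φ : FreeBooleanGraev X x₀ →+ FreeBooleanGraev Z (p x₀),
      (∀ x, φ (of x₀ x) = of (p x₀) (p x)) ∧ IsQuotientMap φ := by
  obtain ⟨φ, ⟨hφc, hφ⟩, -⟩ := existsUnique_lift x₀ (add_self (p x₀)) (fun x => of (p x₀) (p x))
    ((continuous_of _).comp hp.continuous) (of_base _)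
  let π : FreeBooleanGraev X x₀ →+ FreeBooleanGraev X x₀ ⧸ φ.ker := QuotientAddGroup.mk' φ.ker
  let κ : FreeBooleanGraev X x₀ ⧸ φ.ker →+ FreeBooleanGraev Z (p x₀) := QuotientAddGroup.kerLift φ
  have hκ : ∀ a, κ (π a) = φ a := fun a => QuotientAddGroup.kerLift_mk φ a
  let r : Z → X := Function.surjInv hp.surjective
  have hr : ∀ z, p (r z) = z := Function.surjInv_eq hp.surjective
  have hπr : ∀ x, π (of x₀ (r (p x))) = π (of x₀ x) := fun x =>
    QuotientAddGroup.kerLift_injective φ ((hκ _).trans ((by rw [hφ, hφ, hr] :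
      φ (of x₀ (r (p x))) = φ (of x₀ x)).trans (hκ _).symm))
  have hπc : Continuous π := continuous_quot_mk
  obtain ⟨ψ, ⟨hψc, hψ⟩, -⟩ := existsUnique_lift (p x₀) (H := FreeBooleanGraev X x₀ ⧸ φ.ker)
    (fun a => by
      obtain ⟨b, rfl⟩ := QuotientAddGroup.mk'_surjective φ.ker a
      rw [← map_add, add_self, map_zero])
    (fun z => π (of x₀ (r z)))
    (hp.continuous_iff.2 ((hπc.comp (continuous_of x₀)).congr fun x => (hπr x).symm))
    (by rw [hπr, of_base, map_zero])
  have hκψ : ∀ b, κ (ψ b) = b := by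
    have : κ.comp ψ = AddMonoidHom.id _ := hom_ext fun z => by
      change κ (ψ (of (p x₀) z)) = of (p x₀) z
      rw [hψ, hκ, hφ, hr]
    exact fun b => DFunLike.congr_fun this b
  refine ⟨φ, hφ, ⟨isCoinducing_iff.2 fun s => ⟨fun hs => ?_, fun hs => hs.preimage hφc⟩,
    fun b => ?_⟩⟩
  · have hκs : IsOpen (κ ⁻¹' s) := by
      rw [← (QuotientAddGroup.isQuotientMap_mk (N := φ.ker)).isOpen_preimage]
      exact hs
    have := hκs.preimage hψc
    rwa [← preimage_comp, (funext hκψ : κ ∘ ψ = id), preimage_id] at this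
  · obtain ⟨a, ha⟩ := QuotientAddGroup.mk'_surjective φ.ker (ψ b)
    exact ⟨a, by rw [← hκ, ← hκψ b]; exact congrArg κ ha⟩

/-- A continuous function `f` with values in `[0, 1]` defines a continuous homomorphism to
`StepGroup` that detects `f u ≠ 0` on the differences `u - x`, where `f x = 0`. -/
theorem exists_hom_stepGroup {X : Type*} [TopologicalSpace X] (x₀ : X) {f : X → ℝ}
    (hf : Continuous f) (hf01 : ∀ u, f u ∈ Icc (0 : ℝ) 1) :
    ∃ φ : FreeBooleanGraev X x₀ →+ StepGroup, Continuous φ ∧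
      ∀ x u, f x = 0 → (f u = 0 → φ (of x₀ u - of x₀ x) = 0) ∧
        (f u ≠ 0 → 0 < ‖φ (of x₀ u - of x₀ x)‖) := by
  obtain ⟨φ, ⟨hφc, hφ⟩, -⟩ := existsUnique_lift x₀ StepGroup.add_self
    (fun x => StepGroup.step (f x) - StepGroup.step (f x₀))
    ((StepGroup.continuous_step.comp hf).sub continuous_const) (sub_self _)
  refine ⟨φ, hφc, fun x u hx => ?_⟩
  have h : φ (of x₀ u - of x₀ x) = StepGroup.step (f u) - StepGroup.step 0 := by
    rw [map_sub, hφ, hφ, hx]; abel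
  rw [h]
  exact ⟨fun hu => by rw [hu, sub_self], fun hu => StepGroup.norm_step_sub_pos (hf01 u) hu⟩

theorem eq_of_not_isPPoint {X : Type*} [TopologicalSpace X] [T35Space X] {x₀ : X}
    (hB : IsFPrimeSpace (FreeBooleanGraev X x₀)) {x y : X} (hx : ¬ IsPPoint x)
    (hy : ¬ IsPPoint y) : x = y := by
  by_contra hxy
  obtain ⟨f, hf, hf01, hfx, hfx', hfy, hfy'⟩ := exists_continuous_of_not_isPPoint_of_ne hx hxy
  obtain ⟨g, hg, hg01, hgy, hgy', hgx, hgx'⟩ :=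
    exists_continuous_of_not_isPPoint_of_ne hy (Ne.symm hxy)
  obtain ⟨φ, hφc, hφ⟩ := exists_hom_stepGroup x₀ hf hf01
  obtain ⟨ψ, hψc, hψ⟩ := exists_hom_stepGroup x₀ hg hg01
  have hlim : ∀ z : X, Tendsto (fun u => of x₀ u - of x₀ z) (𝓝 z) (𝓝 0) := fun z => by
    have := ((continuous_of x₀).sub (continuous_const (y := of x₀ z))).tendsto z
    rwa [Pi.sub_apply, sub_self] at this
  have hdisj : Disjoint {a | ‖φ a‖ < ‖ψ a‖} {a | ‖ψ a‖ < ‖φ a‖} :=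
    disjoint_left.2 fun _ h h' => lt_asymm (mem_ofPred_eq ▸ h) h'
  have hcl := disjoint_left.1 <|
    hB _ _ (isCozero_lt hφc.norm hψc.norm) (isCozero_lt hψc.norm hφc.norm) hdisj
  refine @hcl 0 ?_ ?_
  · refine mem_closure_iff_frequently.2 ((hlim y).frequently ?_)
    refine (hgy'.and_eventually hfy').mono fun u hu => ?_
    change ‖φ _‖ < ‖ψ _‖
    rw [(hφ y u hfy).1 hu.2, norm_zero]
    exact (hψ y u hgy).2 hu.1
  · refine mem_closure_iff_frequently.2 ((hlim x).frequently ?_)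
    refine (hfx'.and_eventually hgx').mono fun u hu => ?_
    change ‖ψ _‖ < ‖φ _‖
    rw [(hψ x u hgx).1 hu.2, norm_zero]
    exact (hφ x u hfx).2 hu.1

end FreeBooleanGraev

/-! ### Countable quotients with a single nonisolated point -/

theorem IsPPoint.eventually_eq {X : Type*} [TopologicalSpace X] {x : X} (hx : IsPPoint x)
    {f : X → ℝ} (hf : Continuous f) : ∀ᶠ u in 𝓝 x, f u = f x := by
  have hG : IsGδ (f ⁻¹' {f x}) := (isClosed_singleton.isGδ).preimage hf
  have := hx _ hG (singleton_subset_iff.2 rfl)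
  rwa [nhdsSet_singleton] at this

/-- A space in which all points but one are isolated and closed is Tychonoff: the singletons of these
points and the open sets containing the exceptional point form a base of clopen sets. -/
theorem t35Space_of_isClopen_singleton {Z : Type*} [TopologicalSpace Z] (a : Z)
    (h : ∀ z, z ≠ a → IsClopen ({z} : Set Z)) : T35Space Z := by
  have hopen : ∀ s : Set Z, a ∉ s → IsOpen s := fun s hs => by
    rw [← biUnion_of_singleton s]
    exact isOpen_biUnion fun z hz => (h z fun hza => hs (hza ▸ hz)).isOpen
  have hclopen : ∀ s : Set Z, IsOpen s → a ∈ s → IsClopen s := fun s hs ha =>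
    ⟨isOpen_compl_iff.1 (hopen _ fun h => h ha), hs⟩
  have : T1Space Z := ⟨fun z => by
    by_cases hz : z = a
    · exact isOpen_compl_iff.1 (hopen _ fun h => h hz.symm)
    · exact (h z hz).isClosed⟩
  have : CompletelyRegularSpace Z := .of_isTopologicalBasis_clopens <|
    TopologicalSpace.isTopologicalBasis_of_isOpen_of_nhds (fun s hs => hs.isOpen)
      fun z s hz hs => by
        by_cases hza : z = a
        · exact ⟨s, hclopen s hs (hza ▸ hz), hz, subset_rfl⟩
        · exact ⟨{z}, h z hza, rfl, singleton_subset_iff.2 hz⟩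
  exact {}

theorem exists_isQuotientMap_countable {X : Type u} [TopologicalSpace X] [T35Space X] {x : X}
    (hx : ¬ IsPPoint x) (hP : ∀ y, y ≠ x → IsPPoint y) :
    ∃ (Z : Type u) (_ : TopologicalSpace Z) (_ : T35Space Z) (p : X → Z),
      Countable Z ∧ (∃! z : Z, ¬ IsOpen ({z} : Set Z)) ∧ IsQuotientMap p := by
  obtain ⟨f, hf, hf01, hfx, hfne⟩ := exists_continuous_of_not_isPPoint hx
  -- `q` is `0` on the zero set, by the convention `0⁻¹ = 0`, and at least `1` elsewhere.
  let q : X → ℕ := fun u => ⌊(f u)⁻¹⌋₊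
  have hq0 : ∀ u, q u = 0 ↔ f u = 0 := fun u => by
    constructor
    · intro h
      by_contra hu
      have hpos : 0 < f u := lt_of_le_of_ne (hf01 u).1 (Ne.symm hu)
      exact (Nat.floor_eq_zero.1 h).not_ge ((one_le_inv₀ hpos).2 (hf01 u).2)
    · intro h; simp [q, h]
  let p : X → Quotient (Setoid.ker q) := Quotient.mk _
  have hp : IsQuotientMap p := isQuotientMap_quotient_mk'
  have hpq : ∀ u v, p u = p v ↔ q u = q v := fun u v => Quotient.eq
  have hfib : ∀ u, p ⁻¹' {p u} = {v | q v = q u} := fun u => Set.ext fun v => hpq v u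
  have hloc : ∀ u, f u ≠ 0 → ∀ᶠ v in 𝓝 u, q v = q u := fun u hu => by
    filter_upwards [(hP u fun h => hu (h ▸ hfx)).eventually_eq hf] with v hv
    simp only [q, hv]
  have hclopen : ∀ z, z ≠ p x → IsClopen ({z} : Set (Quotient (Setoid.ker q))) := fun z hz => by
    obtain ⟨u, rfl⟩ := hp.surjective z
    have hu : f u ≠ 0 := fun h => hz ((hpq u x).2 (((hq0 u).2 h).trans ((hq0 x).2 hfx).symm))
    rw [← hp.isClopen_preimage, hfib]
    constructor
    · refine isOpen_compl_iff.1 (isOpen_iff_mem_nhds.2 fun v (hv : q v ≠ q u) => ?_)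
      by_cases hv0 : f v = 0
      · -- Where `f` is small, `f⁻¹` is large or zero, so `q` avoids the value `q u ≠ 0`.
        have hlt : ∀ᶠ w in 𝓝 v, f w < ((q u : ℝ) + 1)⁻¹ :=
          hf.continuousAt.eventually_lt continuousAt_const (by rw [hv0]; positivity)
        filter_upwards [hlt] with w hw hwu
        have hwu : q w = q u := hwu
        have hw0 : f w ≠ 0 := fun h => hu ((hq0 u).1 (hwu ▸ (hq0 w).2 h))
        have hpos : 0 < f w := lt_of_le_of_ne (hf01 w).1 (Ne.symm hw0)
        have h1 : (q u : ℝ) + 1 < (f w)⁻¹ := (lt_inv_comm₀ hpos (by positivity)).1 hw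
        have h2 : (f w)⁻¹ < (q w : ℝ) + 1 := Nat.lt_floor_add_one _
        rw [hwu] at h2
        exact lt_asymm h1 h2
      · filter_upwards [hloc v hv0] with w hw hwu
        exact hv (hw.symm.trans hwu)
    · exact isOpen_iff_mem_nhds.2 fun v (hv : q v = q u) => by
        have hv0 : f v ≠ 0 := fun h => hu ((hq0 u).1 (hv ▸ (hq0 v).2 h))
        filter_upwards [hloc v hv0] with w hw using hw.trans hv
  have hcount : Countable (Quotient (Setoid.ker q)) :=
    (Setoid.kerLift_injective q).countable
  refine ⟨_, inferInstance, t35Space_of_isClopen_singleton (p x) hclopen, p, hcount,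
    ⟨p x, fun ho => ?_, fun z hz => by_contra fun hzx => hz (hclopen z hzx).isOpen⟩, hp⟩
  refine hfne ?_
  filter_upwards [(ho.preimage hp.continuous).mem_nhds rfl] with u hu
  exact not_not.2 ((hq0 u).1 (((hpq u x).1 hu).trans ((hq0 x).2 hfx)))

theorem Topology.IsQuotientMap.isRQuotientMap {X Y : Type*} [TopologicalSpace X]
    [TopologicalSpace Y] {p : X → Y} (hp : IsQuotientMap p) : IsRQuotientMap p :=
  ⟨hp.continuous, hp.surjective, fun _ => hp.continuous_iff⟩

theorem mainTheorem7 (X : Type u) [TopologicalSpace X] [T35Space X] (x₀ : X)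
    (hB : IsFPrimeSpace (FreeBooleanGraev X x₀)) :
    (∀ x y : X, ¬ IsPPoint x → ¬ IsPPoint y → x = y) ∧
    (¬ IsPSpace X →
      ∃ (Z : Type u) (_ : TopologicalSpace Z) (_ : T35Space Z) (p : X → Z),
        Countable Z ∧ (∃! z : Z, ¬ IsOpen ({z} : Set Z)) ∧ IsRQuotientMap p ∧
        ExtremallyDisconnected (FreeBooleanGraev Z (p x₀)) ∧
        ∃ φ : FreeBooleanGraev X x₀ →+ FreeBooleanGraev Z (p x₀),
          (∀ x : X, φ (FreeBooleanGraev.of x₀ x) = FreeBooleanGraev.of (p x₀) (p x)) ∧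
          IsQuotientMap φ) := by
  refine ⟨fun x y hx hy => FreeBooleanGraev.eq_of_not_isPPoint hB hx hy, fun hX => ?_⟩
  obtain ⟨x, hx⟩ := not_forall.1 hX
  have hP : ∀ y, y ≠ x → IsPPoint y := fun y hyx =>
    by_contra fun hy => hyx (FreeBooleanGraev.eq_of_not_isPPoint hB hy hx)
  obtain ⟨Z, _, _, p, hZ, hZ', hp⟩ := exists_isQuotientMap_countable hx hP
  obtain ⟨φ, hφ, hφq⟩ := FreeBooleanGraev.exists_isQuotientMap hp x₀
  have hBZ := hB.of_isOpenQuotientMap (AddMonoidHom.isOpenQuotientMap_of_isQuotientMap hφq)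
  exact ⟨Z, _, ‹_›, p, hZ, hZ', hp.isRQuotientMap, hBZ.extremallyDisconnected_of_countable,
    φ, hφ, hφq⟩
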